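/- For graphs $G,F_1,\dots,F_r$, write $G\to(F_1,\dots,F_r)$ if every colouring of $E(G)$ with colours $1,\dots,r$ contains, for some $i$, a copy of $F_i$ all of whose edges have colour $i$. Let $\hat r(F_1,\dots,F_r)=\min\{e(G)\mid G\to(F_1,\dots,F_r)\}$, where $G$ ranges over finite graphs and $e(G)$ is the number of edges of $G$; let $K_{s,t}$ be the complete bipartite graph with parts of sizes $s$ and $t$. Let $r\ge q\ge 1$ be integers, let $t_1,\dots,t_q>0$ be reals, and let $s_1,\dots,s_r,t_{q+1},\dots,t_r$ be positive integers with $t_i\ge s_i$ for $q<i\le r$. For $1\le i\le q$ let $(t_{i,n})_{n}$ be a sequence of non-negative integers with $t_{i,n}=t_in+o(n)$ as $n\to\infty$. Put $$\mathbf F_n=(K_{s_1,t_{1,n}},\dots,K_{s_q,t_{q,n}},K_{s_{q+1},t_{q+1}},\dots,K_{s_r,t_r}).$$ Then $\hat r(\mathbf F_n)$ is well defined (some finite graph arrows $\mathbf F_n$) for every $n$, and the limit $\Lambda=\lim_{n\to\infty}\hat r(\mathbf F_n)/n$ exists and is finite. Moreover, for every integer $l>\Lambda/(t_1+\dots+t_q)$,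 there is for every $n$ some $K_{s,t}\to\mathbf F_n$ with $s\le l$, and $$\lim_{n\to\infty}\frac{\hat r(\mathbf F_n)}{n}=\lim_{n\to\infty}\frac{\min\{e(K_{s,t})\mid s\le l,\ K_{s,t}\to\mathbf F_n\}}{n}.$$ -/

import Mathlib

open Filter Topology Asymptotics

namespace SizeRamsey

/-- `G → (F₀, …, F_{r-1})`: every `r`-colouring of the edges of `G` (not necessarily proper) has,
for some colour `i`, a copy of `F i` all of whose edges have colour `i`. -/
def Arrows {V : Type*} (G : SimpleGraph V) {r : ℕ} {W : Fin r → Type*}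
    (F : ∀ i, SimpleGraph (W i)) : Prop :=
  ∀ c : G.EdgeLabeling (Fin r), ∃ i, (F i).IsContained (c.labelGraph i)

/-- The numbers of edges of the finite graphs that arrow `F`. -/
def arrowingSizes {r : ℕ} {W : Fin r → Type*} (F : ∀ i, SimpleGraph (W i)) : Set ℕ :=
  {e | ∃ (m : ℕ) (G : SimpleGraph (Fin m)), Arrows G F ∧ G.edgeSet.ncard = e}

/-- The size Ramsey number of `F`: the least number of edges of a graph arrowing `F`. -/
noncomputable def sizeRamsey {r : ℕ} {W : Fin r → Type*} (F : ∀ i, SimpleGraph (W i)) : ℕ :=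
  sInf (arrowingSizes F)

/-- The complete bipartite graph with parts of sizes `s` and `t`. -/
abbrev K (s t : ℕ) : SimpleGraph (Fin s ⊕ Fin t) :=
  completeBipartiteGraph (Fin s) (Fin t)

/-- The numbers of edges of the graphs `K s t` with `s ≤ l` that arrow `F`. -/
def bipartiteArrowingSizes (l : ℕ) {r : ℕ} {W : Fin r → Type*} (F : ∀ i, SimpleGraph (W i)) :
    Set ℕ :=
  {e | ∃ s t : ℕ, s ≤ l ∧ Arrows (K s t) F ∧ (K s t).edgeSet.ncard = e}

/-- The least number of edges of a graph `K s t` with `s ≤ l` that arrows `F`. -/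
noncomputable def bipartiteSizeRamsey (l : ℕ) {r : ℕ} {W : Fin r → Type*}
    (F : ∀ i, SimpleGraph (W i)) : ℕ :=
  sInf (bipartiteArrowingSizes l F)

/-- The tuple `(K_{s_1,t_{1,n}}, …, K_{s_q,t_{q,n}}, K_{s_{q+1},t_{q+1}}, …, K_{s_{q+p},t_{q+p}})`
of forbidden graphs; `tn i n` is the second part size of the `i`-th growing graph and `tfix j` that
of the `j`-th fixed graph. -/
def forbidden {q p : ℕ} (s : Fin (q + p) → ℕ) (tn : Fin q → ℕ → ℕ) (tfix : Fin p → ℕ) (n : ℕ)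
    (i : Fin (q + p)) :
    SimpleGraph (Fin (s i) ⊕ Fin (Fin.append (fun j => tn j n) tfix i)) :=
  K (s i) (Fin.append (fun j => tn j n) tfix i)

end SizeRamsey

/-!
The number `Λ` is the threshold of a fractional colouring problem. In a colouring of `K k N`,
each right vertex has a pattern, the function giving the colours of its edges to the `k` left
vertices. Forbidding the fixed graphs means, up to boundedly many right vertices, that each fixed
colour `j` is used fewer than `s j` times in every pattern; forbidding the growing graphs bounds,
for each set `S` of `s i` left vertices, the number of patterns that are constantly `i` on `S`.
`Feasible s t k a` says that the proportions of patterns can be chosen for a graph with `k` left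
vertices and about `a * n` edges, and `Λ` is the supremum of the `a ≥ 0` that are feasible for
every `k`.

Lower bound (`exists_mul_le_of_arrows`, `eventually_lt_ncard_of_arrows`). Let `G` have at most
`x * n` edges with `x < Λ`. Only a bounded set `L` of vertices has degree linear in `n` with a
positive constant, and the left side of a growing forbidden graph has to lie in `L`. Vertices
outside `L` are grouped by their neighbourhood `A` in `L`, and each group is coloured by rounding
a fractional colouring on `#A` left vertices (`exists_assignment`). A group of `m` vertices
contributes at most about `m * #A * t i / a` common neighbours to a set `S ⊆ A`, and these
contributions add up to at most `e(G) * t i / a`, which is less than `t i * n`.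

Upper bound (`arrows_of_not_feasible`, `eventually_arrows_of_not_feasible`). If `a > Λ`, then `a`
is infeasible for some `k`, so `K k N` with slightly more than `a * n` edges arrows the tuple.
Since constant patterns of the growing colours show that `a ≤ k * ∑ i, t i` is feasible
(`feasible_of_le`), choosing `a` below `l * ∑ i, t i` forces `k < l`. This gives the bipartite
graphs with at most `l` left vertices, and no attainment of the supremum is needed.
-/

namespace SizeRamsey

open Finset

variable {q p : ℕ}

/-! ### Fractional colourings and their rounding -/

/-- The fractional colouring problem on `k` left vertices. A right vertex joined to all of them
is coloured by a pattern `f : Fin k → Fin (q + p)`, and `w` is a probability distribution on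
patterns. Patterns of positive weight use each fixed colour `j` on fewer than `s j` left
vertices; for a growing colour `i`, the patterns that are constantly `i` on a given set of `s i`
left vertices have total weight at most `k * t i / a`, the bound being written without division.

If a `K k N` with about `a * n` edges is coloured according to `w`, then every set of `s i` left
vertices has at most `t i * n` common neighbours in the growing colour `i`. -/
def Feasible (s : Fin (q + p) → ℕ) (t : Fin q → ℝ) (k : ℕ) (a : ℝ) : Prop :=
  ∃ w : (Fin k → Fin (q + p)) → ℝ, (∀ f, 0 ≤ w f) ∧ ∑ f, w f = 1 ∧
    (∀ f, w f ≠ 0 → ∀ j, #{u | f u = Fin.natAdd q j} < s (Fin.natAdd q j)) ∧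
    ∀ i (S : Finset (Fin k)), #S = s (Fin.castAdd p i) →
      a * ∑ f with ∀ u ∈ S, f u = Fin.castAdd p i, w f ≤ k * t i

/-- A finite set can be distributed over bins of prescribed capacities with sufficient total. -/
theorem exists_forall_card_fiber_le {α β : Type*} [Fintype β] [DecidableEq β]
    (X : Finset α) (c : β → ℕ) (hc : #X ≤ ∑ b, c b) :
    ∃ g : X → β, ∀ b, #{x | g x = b} ≤ c b := by
  have : Nonempty (X ↪ (Σ b, Fin (c b))) := by
    apply Function.Embedding.nonempty_of_card_le
    simpa using hc
  obtain ⟨e⟩ := this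
  refine ⟨fun x => (e x).1, fun b => ?_⟩
  calc #{x | (e x).1 = b} = #(({x | (e x).1 = b} : Finset X).map e) := by simp
    _ ≤ #((univ : Finset (Fin (c b))).map
          ⟨Sigma.mk (β := fun b => Fin (c b)) b, sigma_mk_injective⟩) := by
        apply card_le_card
        intro y
        simp only [Finset.mem_map, mem_filter_univ, Function.Embedding.coeFn_mk]
        rintro ⟨x, hx, rfl⟩
        subst hx
        exact ⟨(e x).2, mem_univ _, rfl⟩
    _ = c b := by simp

/-- Rounding a fractional colouring: the vertices of `X`, each joined to all of `A`, choose
patterns in nearly the proportions given by the weights. Here `h v u` is the colour of the edge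
from `v ∈ X` to `u ∈ A`; rounding up costs one vertex per pattern. -/
theorem exists_assignment (hq : 1 ≤ q) {s : Fin (q + p) → ℕ} {t : Fin q → ℝ} {a : ℝ}
    (ha : 0 ≤ a) {V : Type*} [DecidableEq V] (A X : Finset V) (hA : Feasible s t #A a) :
    ∃ h : V → V → Fin (q + p),
      (∀ v ∈ X, ∀ j, #{u ∈ A | h v u = Fin.natAdd q j} < s (Fin.natAdd q j)) ∧
      ∀ i, ∀ S ⊆ A, #S = s (Fin.castAdd p i) →
        a * #{v ∈ X | ∀ u ∈ S, h v u = Fin.castAdd p i} ≤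
          #X * #A * t i + a * (q + p) ^ #A := by
  obtain ⟨w, hw0, hw1, hwf, hwS⟩ := hA
  have hc : #X ≤ ∑ f, ⌈#X * w f⌉₊ := by
    have : (#X : ℝ) ≤ ∑ f, (⌈#X * w f⌉₊ : ℝ) := by
      calc (#X : ℝ) = ∑ f, #X * w f := by rw [← mul_sum, hw1, mul_one]
        _ ≤ _ := sum_le_sum fun f _ => Nat.le_ceil _
    exact_mod_cast this
  obtain ⟨g, hg⟩ := exists_forall_card_fiber_le X _ hc
  let e := A.equivFin
  let h : V → V → Fin (q + p) := fun v u =>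
    if hv : v ∈ X then if hu : u ∈ A then g ⟨v, hv⟩ (e ⟨u, hu⟩) else ⟨0, by omega⟩
    else ⟨0, by omega⟩
  have hh : ∀ (v : X) (u : A), h v u = g v (e u) := fun v u => by simp [h]
  refine ⟨h, fun v hv j => ?_, fun i S hS hcard => ?_⟩
  -- A pattern of weight zero has capacity zero, so only admissible patterns are chosen.
  · have hne : w (g ⟨v, hv⟩) ≠ 0 := by
      intro h0
      have h1 := hg (g ⟨v, hv⟩)
      rw [h0, mul_zero, Nat.ceil_zero, Nat.le_zero, card_eq_zero] at h1
      have : (⟨v, hv⟩ : X) ∈ ({x | g x = g ⟨v, hv⟩} : Finset X) := by simp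
      rw [h1] at this
      simp at this
    refine lt_of_le_of_lt ?_ (hwf _ hne j)
    refine le_trans (card_le_card ?_) (card_image_le (f := fun x => (e.symm x : V)))
    intro u hu
    obtain ⟨huA, hu⟩ := mem_filter.1 hu
    refine mem_image.2 ⟨e ⟨u, huA⟩, ?_, by simp⟩
    rw [mem_filter, ← hh ⟨v, hv⟩ ⟨u, huA⟩]
    exact ⟨mem_univ _, hu⟩
  · let S' : Finset (Fin #A) := univ.filter fun x => (e.symm x : V) ∈ S
    have hS' : #S' = #S := by
      symm
      apply card_bij (fun u hu => e ⟨u, hS hu⟩)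
      · intro u hu; simp [S', hu]
      · intro u hu v hv huv; simpa using huv
      · intro x hx
        refine ⟨e.symm x, by simpa [S'] using hx, by simp⟩
    have h1 := hwS i S' (hS'.trans hcard)
    have h2 : #{v ∈ X | ∀ u ∈ S, h v u = Fin.castAdd p i} ≤
        ∑ f with ∀ u ∈ S', f u = Fin.castAdd p i, ⌈#X * w f⌉₊ := by
      calc _ ≤ #{x : X | ∀ u ∈ S', g x u = Fin.castAdd p i} := by
            rw [← card_map (Function.Embedding.subtype _)]
            apply card_le_card
            intro v hv
            simp only [mem_filter] at hv
            simp only [Finset.mem_map, mem_filter, mem_univ, true_and,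
              Function.Embedding.subtype_apply]
            refine ⟨⟨v, hv.1⟩, fun x hx => ?_, rfl⟩
            have := hv.2 (e.symm x) (by simpa [S'] using hx)
            have h3 := hh ⟨v, hv.1⟩ (e.symm x)
            simp only [Equiv.apply_symm_apply] at h3
            rw [← h3, this]
        _ = ∑ f with ∀ u ∈ S', f u = Fin.castAdd p i, #{x : X | g x = f} := by
            rw [card_eq_sum_card_fiberwise (f := g)
              (t := {f | ∀ u ∈ S', f u = Fin.castAdd p i}) (by intro x; simp)]
            refine sum_congr rfl fun f hf => ?_
            congr 1
            ext x
            simp only [mem_filter, mem_univ, true_and] at hf ⊢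
            constructor
            · exact fun h => h.2
            · rintro rfl; exact ⟨hf, rfl⟩
        _ ≤ _ := sum_le_sum fun f _ => hg f
    calc a * #{v ∈ X | ∀ u ∈ S, h v u = Fin.castAdd p i}
        ≤ a * ∑ f with ∀ u ∈ S', f u = Fin.castAdd p i, (#X * w f + 1) := by
          gcongr
          calc _ ≤ ((∑ f with ∀ u ∈ S', f u = Fin.castAdd p i, ⌈#X * w f⌉₊ : ℕ) : ℝ) := by
                exact_mod_cast h2
            _ ≤ _ := by
                push_cast
                exact sum_le_sum fun f _ =>
                  (Nat.ceil_lt_add_one (mul_nonneg (Nat.cast_nonneg _) (hw0 f))).le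
      _ = #X * (a * ∑ f with ∀ u ∈ S', f u = Fin.castAdd p i, w f) +
            a * #{f : Fin #A → Fin (q + p) | ∀ u ∈ S', f u = Fin.castAdd p i} := by
          rw [sum_add_distrib, ← mul_sum]
          simp
          ring
      _ ≤ #X * (#A * t i) + a * (q + p) ^ #A := by
          gcongr
          have := card_filter_le (univ : Finset (Fin #A → Fin (q + p)))
            (fun f => ∀ u ∈ S', f u = Fin.castAdd p i)
          simp only [card_univ, Fintype.card_fun, Fintype.card_fin] at this
          exact_mod_cast this
      _ = _ := by ring

/-! ### Colouring graphs with few edges -/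

theorem sum_card_neighbors_le_card_edges {V : Type*} [Fintype V] [DecidableEq V]
    (G : SimpleGraph V) [DecidableRel G.Adj] (L : Finset V) :
    ∑ v ∈ Lᶜ, #{u ∈ L | G.Adj v u} ≤ G.edgeSet.ncard := by
  rw [← SimpleGraph.coe_edgeFinset, Set.ncard_coe_finset, ← card_sigma]
  apply card_le_card_of_injOn (fun x => s(x.1, x.2))
  · rintro ⟨v, u⟩ hx
    simp only [coe_sigma, Set.mem_sigma_iff, mem_coe, mem_filter] at hx
    simpa using hx.2.2
  · rintro ⟨v, u⟩ hx ⟨v', u'⟩ hx' h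
    simp only [coe_sigma, Set.mem_sigma_iff, mem_coe, mem_filter, mem_compl] at hx hx'
    rcases Sym2.eq_iff.1 h with ⟨h1, h2⟩ | ⟨h1, h2⟩
    · simp_all
    · simp_all

/-- The lower bound for a single graph: if `G` arrows the tuple and every vertex outside the
small set `L` has degree below all `T i`, then `G` has, up to a constant, at least
`a * T i / t i` edges for some `i`.

Otherwise edges between `L` and its complement are coloured by rounding, for each `A ⊆ L`, a
fractional colouring of the vertices outside `L` whose neighbourhood in `L` is `A`; other edges
receive a growing colour. In a fixed colour, an edge has an endpoint outside `L` with too few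
neighbours of that colour. In a growing colour `i`, the side of size `s i` has to lie in `L`, and
the bounds on its common neighbours add up over all `A` because the sizes of the neighbourhoods
`A` add up to at most the number of edges. -/
theorem exists_mul_le_of_arrows (hq : 1 ≤ q) {s : Fin (q + p) → ℕ} (hs : ∀ i, 1 ≤ s i)
    {t : Fin q → ℝ} (ht : ∀ i, 0 ≤ t i)
    {tfix : Fin p → ℕ} (htfix : ∀ j, s (Fin.natAdd q j) ≤ tfix j) {a : ℝ} (ha : 0 ≤ a)
    (hA : ∀ k, Feasible s t k a) {V : Type*} [Fintype V] (G : SimpleGraph V)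
    [DecidableRel G.Adj] (T : Fin q → ℕ) (L : Finset V) {D : ℕ} (hL : #L ≤ D)
    (hdeg : ∀ v i, T i ≤ G.degree v → v ∈ L)
    (harr : Arrows G (fun i => K (s i) (Fin.append T tfix i))) :
    ∃ i, a * T i ≤ t i * G.edgeSet.ncard + a * (2 ^ D * (q + p) ^ D + D) := by
  classical
  let N : V → Finset V := fun v => {u ∈ L | G.Adj v u}
  let X : Finset V → Finset V := fun A => {v ∈ Lᶜ | N v = A}
  choose h hfix hgrow using fun A => exists_assignment hq ha A (X A) (hA #A)
  -- The default colour is a growing one, as `q` is positive.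
  let z : Fin (q + p) := ⟨0, by omega⟩
  let col : V → V → Fin (q + p) := fun x y =>
    if x ∉ L ∧ y ∈ L then h (N x) x y else if y ∉ L ∧ x ∈ L then h (N y) y x else z
  have hcol : ∀ x y, col y x = col x y := by
    intro x y
    by_cases hx : x ∈ L <;> by_cases hy : y ∈ L <;> simp [col, hx, hy]
  let c : G.EdgeLabeling (Fin (q + p)) :=
    SimpleGraph.EdgeLabeling.mk (fun x y _ => col x y) (fun x y _ => hcol x y)
  have hc : ∀ i x y, (c.labelGraph i).Adj x y → G.Adj x y ∧ col x y = i := by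
    intro i x y hxy
    obtain ⟨h1, h2⟩ := (SimpleGraph.EdgeLabeling.labelGraph_adj _ _).1 hxy
    exact ⟨h1, h2⟩
  have hin : ∀ x y, x ∉ L → y ∈ L → col x y = h (N x) x y := by
    intro x y hx hy; simp [col, hx, hy]
  obtain ⟨i, hi⟩ := harr c
  obtain ⟨left, right, hl, hr, hlr⟩ := SimpleGraph.completeBipartiteGraph_isContained_iff.1 hi
  simp only [Fintype.card_fin] at hl hr
  induction i using Fin.addCases with
  | right j =>
    exfalso
    rw [Fin.append_right] at hr
    have hz : z ≠ Fin.natAdd q j := by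
      intro h; have := congrArg Fin.val h; simp [z] at this; omega
    have key : ∀ x ∉ L, ∀ S : Finset V, s (Fin.natAdd q j) ≤ #S →
        (∀ y ∈ S, G.Adj x y ∧ col x y = Fin.natAdd q j) → False := by
      intro x hx S hS hy
      refine absurd (hfix (N x) x (by simp [X, hx]) j) (not_lt.2 (hS.trans (card_le_card ?_)))
      intro y hyS
      obtain ⟨h1, h2⟩ := hy y hyS
      have hyL : y ∈ L := by
        by_contra hyL
        exact hz (by simpa [col, hx, hyL] using h2)
      simp only [N, mem_filter]
      exact ⟨⟨hyL, h1⟩, by rw [← h2, hin x y hx hyL]⟩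
    obtain ⟨x, hx⟩ : left.Nonempty := card_pos.1 (by rw [hl]; exact hs _)
    obtain ⟨y, hy⟩ : right.Nonempty := card_pos.1 (by
      rw [hr]; exact (hs (Fin.natAdd q j)).trans (htfix j))
    by_cases hxL : x ∈ L
    · by_cases hyL : y ∈ L
      · exact hz (by simpa [col, hxL, hyL] using (hc _ _ _ (hlr hx hy)).2)
      · refine key y hyL left hl.ge fun u hu => ?_
        obtain ⟨h1, h2⟩ := hc _ _ _ (hlr hu hy)
        exact ⟨h1.symm, by rw [hcol, h2]⟩
    · exact key x hxL right (hr ▸ htfix j) fun u hu => hc _ _ _ (hlr hx hu)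
  | left i =>
    rw [Fin.append_left] at hr
    refine ⟨i, ?_⟩
    -- The left side has degree at least `T i`, hence consists of vertices of `L`.
    have hleft : left ⊆ L := by
      intro v hv
      apply hdeg v i
      rw [← hr, ← SimpleGraph.card_neighborFinset_eq_degree]
      apply card_le_card
      intro u hu
      simpa using (hc _ _ _ (hlr hv hu)).1
    let Y : Finset V → Finset V := fun A =>
      {v ∈ X A | left ⊆ A ∧ ∀ u ∈ left, h A v u = Fin.castAdd p i}
    have hright : right ⊆ L ∪ L.powerset.biUnion Y := by
      intro v hv
      by_cases hvL : v ∈ L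
      · exact mem_union_left _ hvL
      · refine mem_union_right _ (mem_biUnion.2 ⟨N v, ?_, ?_⟩)
        · simp [N]
        · simp only [Y, X, mem_filter, mem_compl, hvL, not_false_eq_true, true_and]
          refine ⟨fun u hu => ?_, fun u hu => ?_⟩
          · exact mem_filter.2 ⟨hleft hu, (hc _ _ _ (hlr hu hv)).1.symm⟩
          · rw [← hin v u hvL (hleft hu), hcol, (hc _ _ _ (hlr hu hv)).2]
    have hT : (T i : ℝ) ≤ D + ∑ A ∈ L.powerset, (#(Y A) : ℝ) := by
      have := (card_le_card hright).trans ((card_union_le _ _).trans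
        (add_le_add hL card_biUnion_le))
      rw [hr] at this
      exact_mod_cast this
    have hY : ∀ A ∈ L.powerset, a * #(Y A) ≤ #(X A) * #A * t i + a * (q + p) ^ D := by
      intro A hAL
      have hpow : ((q : ℝ) + p) ^ #A ≤ (q + p) ^ D := by
        apply pow_le_pow_right₀
        · have : (1 : ℝ) ≤ q := by exact_mod_cast hq
          have : (0 : ℝ) ≤ p := by positivity
          linarith
        · exact (card_le_card (mem_powerset.1 hAL)).trans hL
      by_cases hl' : left ⊆ A
      · have h1 := hgrow A i left hl' hl
        refine le_trans (le_trans (le_of_eq ?_) h1)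
          (add_le_add le_rfl (mul_le_mul_of_nonneg_left hpow ha))
        congr 3
        ext v
        simp [Y, hl']
      · have h2 : Y A = ∅ := by simp [Y, hl']
        rw [h2]
        have := ht i
        simp only [card_empty, Nat.cast_zero, mul_zero]
        positivity
    have hedge : ∑ A ∈ L.powerset, (#(X A) * #A : ℝ) ≤ G.edgeSet.ncard := by
      have h1 : ∑ A ∈ L.powerset, #(X A) * #A = ∑ v ∈ Lᶜ, #(N v) := by
        rw [← sum_fiberwise_of_maps_to (g := N) (t := L.powerset) (by simp [N])]
        refine sum_congr rfl fun A _ => ?_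
        rw [sum_congr rfl (g := fun _ => #A) (fun v hv => by rw [(mem_filter.1 hv).2])]
        simp [X]
      exact_mod_cast h1.le.trans (sum_card_neighbors_le_card_edges G L)
    calc a * T i ≤ a * (D + ∑ A ∈ L.powerset, (#(Y A) : ℝ)) := by gcongr
      _ = a * D + ∑ A ∈ L.powerset, a * #(Y A) := by rw [mul_add, mul_sum]
      _ ≤ a * D + ∑ A ∈ L.powerset, (#(X A) * #A * t i + a * (q + p) ^ D) := by
          gcongr with A hA'
          exact hY A hA'
      _ = t i * ∑ A ∈ L.powerset, (#(X A) * #A : ℝ) + a * (2 ^ #L * (q + p) ^ D + D) := by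
          rw [sum_add_distrib, ← sum_mul]
          simp only [sum_const, card_powerset, nsmul_eq_mul]
          push_cast
          ring
      _ ≤ _ := by
          have := ht i
          gcongr
          norm_num

/-! ### Complete bipartite graphs -/

theorem isContained_labelGraph_of_le_card {k N m T : ℕ} {κ : Type*} [DecidableEq κ]
    (c : (K k N).EdgeLabeling κ) (i : κ) (S : Finset (Fin k)) (hS : #S = m)
    (hT : T ≤ #{v : Fin N | ∀ u ∈ S, c.get (.inl u) (.inr v) (by simp) = i}) :
    (K m T).IsContained (c.labelGraph i) := by
  obtain ⟨R, hR, hRT⟩ := exists_subset_card_eq hT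
  refine SimpleGraph.completeBipartiteGraph_isContained_iff.2
    ⟨S.map .inl, R.map .inr, by simpa using hS, by simpa using hRT, ?_⟩
  intro x hx y hy
  simp only [coe_map, Set.mem_image, mem_coe] at hx hy
  obtain ⟨u, hu, rfl⟩ := hx
  obtain ⟨v, hv, rfl⟩ := hy
  exact (SimpleGraph.EdgeLabeling.labelGraph_adj _ _).2 ⟨by simp, (mem_filter.1 (hR hv)).2 u hu⟩

/-- If no fractional colouring on `k` left vertices exists, then `K k N` arrows the tuple as soon
as `N` is large compared with the `T i`: the proportions of the patterns in a colouring without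
forbidden copies would be a fractional colouring, after discarding the boundedly many right
vertices that have some fixed colour `j` on at least `s j` left vertices. -/
theorem arrows_of_not_feasible {s : Fin (q + p) → ℕ} {t : Fin q → ℝ} {tfix : Fin p → ℕ}
    {a : ℝ} (ha : 0 ≤ a) {k : ℕ} (hk : ¬ Feasible s t k a) {N : ℕ} {T : Fin q → ℕ}
    (hN : ((2 ^ k * ∑ j, tfix j : ℕ) : ℝ) < N)
    (hT : ∀ i, a * T i ≤ k * t i * (N - (2 ^ k * ∑ j, tfix j : ℕ))) (ht : ∀ i, 0 ≤ t i) :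
    Arrows (K k N) (fun i => K (s i) (Fin.append T tfix i)) := by
  classical
  intro c
  by_contra! hcon
  refine hk ?_
  set C := 2 ^ k * ∑ j, tfix j
  let g : Fin N → Fin k → Fin (q + p) := fun v u => c.get (.inl u) (.inr v) (by simp)
  have hg : ∀ i S, #S = s i → #{v | ∀ u ∈ S, g v u = i} < Fin.append T tfix i := by
    intro i S hS
    by_contra! h
    exact (hcon i).false (isContained_labelGraph_of_le_card c i S hS h).some
  let X : Finset (Fin N) := {v | ∀ j, #{u | g v u = Fin.natAdd q j} < s (Fin.natAdd q j)}
  have hX : N ≤ #X + C := by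
    -- A discarded vertex is joined in colour `j` to a set of `s j` left vertices; each such set has
    -- fewer than `tfix j` common neighbours of that colour.
    have h1 : Xᶜ ⊆ univ.biUnion fun j : Fin p =>
        (powersetCard (s (Fin.natAdd q j)) univ).biUnion fun S : Finset (Fin k) =>
          ({v | ∀ u ∈ S, g v u = Fin.natAdd q j} : Finset (Fin N)) := by
      intro v hv
      simp only [X, mem_compl, mem_filter_univ, not_forall, not_lt] at hv
      obtain ⟨j, hj⟩ := hv
      obtain ⟨S, hS, hSc⟩ := exists_subset_card_eq hj
      refine mem_biUnion.2 ⟨j, mem_univ _, mem_biUnion.2 ⟨S, by simp [mem_powersetCard, hSc], ?_⟩⟩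
      simpa using fun u hu => (mem_filter.1 (hS hu)).2
    have h2 : #Xᶜ ≤ C := by
      refine (card_le_card h1).trans (card_biUnion_le.trans ?_)
      rw [show C = ∑ j, 2 ^ k * tfix j from mul_sum _ _ _]
      refine sum_le_sum fun j _ => card_biUnion_le.trans ?_
      refine (sum_le_card_nsmul _ _ (tfix j) fun S hS => ?_).trans ?_
      · have := hg _ S (mem_powersetCard.1 hS).2
        rw [Fin.append_right] at this
        exact this.le
      · rw [smul_eq_mul]
        gcongr
        calc _ ≤ #(powerset (univ : Finset (Fin k))) := card_le_card (fun x _ => by simp)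
          _ = _ := by simp
    have h3 := card_add_card_compl X
    rw [Fintype.card_fin] at h3
    omega
  have hXN : (N : ℝ) - C ≤ #X := by
    have : (N : ℝ) ≤ #X + C := by exact_mod_cast hX
    linarith
  have hX0 : (0 : ℝ) < #X := by linarith
  refine ⟨fun f => #{v ∈ X | g v = f} / #X, fun f => by positivity, ?_, ?_, ?_⟩
  · rw [← sum_div, div_eq_one_iff_eq hX0.ne']
    have := card_eq_sum_card_fiberwise (f := g) (s := X) (t := univ) (by simp)
    exact_mod_cast this.symm
  · intro f hf
    have : #{v ∈ X | g v = f} ≠ 0 := by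
      intro h0; simp [h0] at hf
    obtain ⟨v, hv⟩ := card_ne_zero.1 this
    obtain ⟨hvX, rfl⟩ := mem_filter.1 hv
    exact (mem_filter.1 hvX).2
  · intro i S hS
    have h1 : ∑ f with ∀ u ∈ S, f u = Fin.castAdd p i, #{v ∈ X | g v = f} ≤ T i := by
      have h2 := hg _ S hS
      rw [Fin.append_left] at h2
      refine le_trans ?_ h2.le
      calc _ ≤ ∑ f with ∀ u ∈ S, f u = Fin.castAdd p i,
            #{v ∈ ({v | ∀ u ∈ S, g v u = Fin.castAdd p i} : Finset _) | g v = f} := by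
            refine sum_le_sum fun f hf => card_le_card fun v hv => ?_
            obtain ⟨_, rfl⟩ := mem_filter.1 hv
            simpa using hf
        _ = _ := (card_eq_sum_card_fiberwise (by intro v; simp)).symm
    rw [← sum_div, ← mul_div_assoc, div_le_iff₀ hX0]
    calc a * ∑ f with ∀ u ∈ S, f u = Fin.castAdd p i, (#{v ∈ X | g v = f} : ℝ)
        ≤ a * T i := by gcongr; exact_mod_cast h1
      _ ≤ k * t i * (N - C) := hT i
      _ ≤ k * t i * #X := by
          have := ht i
          gcongr

/-- The weights `t i / ∑ i, t i` on the constant patterns of the growing colours form a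
fractional colouring. For `k = 0` the constraints are void, since every `s i` is positive. -/
theorem feasible_of_le {s : Fin (q + p) → ℕ} (hs : ∀ i, 1 ≤ s i) {t : Fin q → ℝ}
    (ht : ∀ i, 0 ≤ t i) (hpos : 0 < ∑ i, t i) {a : ℝ} {k : ℕ}
    (hk : k = 0 ∨ a ≤ k * ∑ i, t i) : Feasible s t k a := by
  refine ⟨fun f => ∑ i, if (fun _ => Fin.castAdd p i) = f then t i / ∑ i, t i else 0,
    fun f => sum_nonneg fun i _ => ?_, ?_, ?_, ?_⟩
  · have := ht i
    split_ifs <;> positivity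
  · rw [sum_comm]
    simp only [sum_ite_eq, mem_univ, if_true]
    rw [← sum_div, div_self hpos.ne']
  · intro f hf j
    obtain ⟨i, -, hi⟩ := exists_ne_zero_of_sum_ne_zero hf
    have hfi : (fun _ => Fin.castAdd p i) = f := by
      by_contra h; simp [h] at hi
    subst hfi
    have : ∀ u : Fin k, Fin.castAdd p i ≠ Fin.natAdd q j := by
      intro u h
      have := congrArg Fin.val h
      simp at this
      omega
    rw [filter_false_of_mem (by simpa using fun u => this u), card_empty]
    exact hs _
  · intro i S hS
    obtain ⟨u, hu⟩ : S.Nonempty := card_pos.1 (hS ▸ hs _)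
    rcases hk with rfl | hk
    · exact u.elim0
    rw [sum_comm]
    simp only [sum_ite_eq]
    have hmem : ∀ i', ((fun _ => Fin.castAdd p i') ∈
        ({f | ∀ u ∈ S, f u = Fin.castAdd p i} : Finset (Fin k → Fin (q + p)))) ↔ i' = i := by
      intro i'
      rw [mem_filter_univ]
      exact ⟨fun h => Fin.castAdd_injective _ _ (h u hu), fun h _ _ => by rw [h]⟩
    simp only [hmem]
    calc _ = a * ∑ i', (if i' = i then t i' / ∑ i, t i else 0) := rfl
      _ = (a / ∑ i, t i) * t i := by simp; ring
      _ ≤ k * t i := by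
          have := ht i
          gcongr
          rwa [div_le_iff₀ hpos]

/-- With `k = ∑ i, s i` left vertices, each admissible pattern takes some growing colour `i` on
at least `s i` left vertices, so the constraints bound the total weight and with it `a`. -/
theorem le_of_feasible (hq : 1 ≤ q) {s : Fin (q + p) → ℕ} {t : Fin q → ℝ}
    (ht : ∀ i, 0 ≤ t i) {a : ℝ} (ha : 0 ≤ a) (h : Feasible s t (∑ i, s i) a) :
    a ≤ 2 ^ (∑ i, s i) * ∑ i, (∑ i, s i : ℕ) * t i := by
  set k := ∑ i, s i with hk
  obtain ⟨w, hw0, hw1, hwf, hwS⟩ := h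
  let P (i : Fin q) : Finset (Finset (Fin k)) := powersetCard (s (Fin.castAdd p i)) univ
  have hf : ∀ f, w f ≤ ∑ i : Fin q, ∑ S ∈ P i,
      if ∀ u ∈ S, f u = Fin.castAdd p i then w f else 0 := by
    intro f
    have hterm : ∀ i : Fin q, ∀ S ∈ P i,
        0 ≤ if ∀ u ∈ S, f u = Fin.castAdd p i then w f else 0 := by
      intro i S _
      have := hw0 f
      split_ifs <;> simp [this]
    by_cases h0 : w f = 0
    · simp [h0]
    obtain ⟨i, hi⟩ : ∃ i : Fin q, s (Fin.castAdd p i) ≤ #{u | f u = Fin.castAdd p i} := by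
      by_contra! hlt
      have h1 := card_eq_sum_card_fiberwise (f := f) (s := univ) (t := univ) (by simp)
      have h2 : ∀ i, #{u | f u = i} < s i := by
        intro i
        induction i using Fin.addCases with
        | left i => exact hlt i
        | right j => exact hwf f h0 j
      rw [card_univ, Fintype.card_fin] at h1
      exact (sum_lt_sum_of_nonempty ⟨⟨0, by omega⟩, mem_univ _⟩ fun i _ => h2 i).ne
        (h1.symm.trans hk)
    obtain ⟨S, hS, hSc⟩ := exists_subset_card_eq hi
    have hSP : S ∈ P i := by simp [P, mem_powersetCard, hSc]
    refine le_trans ?_ (single_le_sum (fun i _ => sum_nonneg (hterm i)) (mem_univ i))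
    refine le_trans ?_ (single_le_sum (hterm i) hSP)
    rw [if_pos fun u hu => (mem_filter.1 (hS hu)).2]
  calc a = a * ∑ f, w f := by rw [hw1, mul_one]
    _ ≤ a * ∑ f, ∑ i : Fin q, ∑ S ∈ P i,
          if ∀ u ∈ S, f u = Fin.castAdd p i then w f else 0 := by
        gcongr with f; exact hf f
    _ = ∑ i : Fin q, ∑ S ∈ P i, a * ∑ f with ∀ u ∈ S, f u = Fin.castAdd p i, w f := by
        rw [sum_comm, mul_sum]
        refine sum_congr rfl fun i _ => ?_
        rw [sum_comm, mul_sum]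
        simp only [sum_filter]
    _ ≤ ∑ i : Fin q, ∑ S ∈ P i, k * t i := by
        refine sum_le_sum fun i _ => sum_le_sum fun S hS => ?_
        exact hwS i S (mem_powersetCard.1 hS).2
    _ ≤ ∑ i : Fin q, 2 ^ k * (k * t i) := by
        gcongr with i
        rw [sum_const, nsmul_eq_mul]
        have := ht i
        gcongr
        have : #(P i) ≤ #(powerset (univ : Finset (Fin k))) := card_le_card (fun x _ => by simp)
        rw [card_powerset, card_univ, Fintype.card_fin] at this
        exact_mod_cast this
    _ = _ := by rw [mul_sum]

theorem Arrows.of_iso {V V' : Type*} {G : SimpleGraph V} {G' : SimpleGraph V'} {r : ℕ}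
    {W : Fin r → Type*} {F : ∀ i, SimpleGraph (W i)} (h : Arrows G F) (e : G ≃g G') :
    Arrows G' F := by
  intro c
  obtain ⟨i, hi⟩ := h (c.pullback e.toHom)
  refine ⟨i, hi.trans ⟨⟨⟨e, ?_⟩, e.injective⟩⟩⟩
  intro x y hxy
  obtain ⟨h1, h2⟩ := (SimpleGraph.EdgeLabeling.labelGraph_adj _ _).1 hxy
  exact (SimpleGraph.EdgeLabeling.labelGraph_adj _ _).2 ⟨e.map_adj_iff.2 h1, h2⟩

theorem ncard_edgeSet_K (k N : ℕ) : (K k N).edgeSet.ncard = k * N := by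
  rw [Set.ncard, SimpleGraph.encard_edgeSet_completeBipartiteGraph]
  simp

theorem bipartiteArrowingSizes_subset (l : ℕ) {r : ℕ} {W : Fin r → Type*}
    (F : ∀ i, SimpleGraph (W i)) : bipartiteArrowingSizes l F ⊆ arrowingSizes F := by
  rintro e ⟨k, N, -, h, rfl⟩
  let φ : K k N ≃g (K k N).map (finSumFinEquiv (m := k) (n := N)).toEmbedding :=
    SimpleGraph.Iso.map finSumFinEquiv (K k N)
  exact ⟨k + N, _, h.of_iso φ, (Nat.card_congr φ.mapEdgeSet).symm⟩

/-! ### Asymptotics -/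

theorem eventually_lt_mul_natCast {x : ℝ} (hx : 0 < x) (C : ℝ) : ∀ᶠ n : ℕ in atTop, C < x * n :=
  (tendsto_natCast_atTop_atTop.const_mul_atTop hx).eventually_gt_atTop C

theorem eventually_add_lt_mul {T : ℕ → ℕ} {t : ℝ} (ht : 0 < t)
    (hT : (fun n : ℕ => (T n : ℝ) - t * n) =o[atTop] (fun n : ℕ => (n : ℝ))) {x a : ℝ}
    (ha : 0 < a) (hxa : x < a) (C : ℝ) : ∀ᶠ n : ℕ in atTop, t * x * n + C < a * T n := by
  have hε : 0 < t * (a - x) / (2 * a) := by have := sub_pos.2 hxa; positivity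
  filter_upwards [hT.def hε, eventually_lt_mul_natCast (x := t * (a - x) / 2)
    (by have := sub_pos.2 hxa; positivity) C] with n h1 h2
  rw [Real.norm_eq_abs, Real.norm_of_nonneg (Nat.cast_nonneg n)] at h1
  have h3 := mul_le_mul_of_nonneg_left (abs_le.1 h1).1 ha.le
  have h4 : a * -(t * (a - x) / (2 * a) * n) = -(t * (a - x) / 2 * n) := by field_simp
  rw [h4] at h3
  nlinarith

theorem eventually_mul_add_lt {T : ℕ → ℕ} {t : ℝ} (ht : 0 < t)
    (hT : (fun n : ℕ => (T n : ℝ) - t * n) =o[atTop] (fun n : ℕ => (n : ℝ))) {a y : ℝ}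
    (ha : 0 < a) (hay : a < y) (C : ℝ) : ∀ᶠ n : ℕ in atTop, a * T n + C < t * y * n := by
  have hε : 0 < t * (y - a) / (2 * a) := by have := sub_pos.2 hay; positivity
  filter_upwards [hT.def hε, eventually_lt_mul_natCast (x := t * (y - a) / 2)
    (by have := sub_pos.2 hay; positivity) C] with n h1 h2
  rw [Real.norm_eq_abs, Real.norm_of_nonneg (Nat.cast_nonneg n)] at h1
  have h3 := mul_le_mul_of_nonneg_left (abs_le.1 h1).2 ha.le
  have h4 : a * (t * (y - a) / (2 * a) * n) = t * (y - a) / 2 * n := by field_simp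
  rw [h4] at h3
  nlinarith

/-- Below a value `a` that is feasible for all `k`, no graph with at most `x * n` edges arrows
the tuple: it has a bounded number of vertices of degree above `τ * n`, and
`exists_mul_le_of_arrows` applies to the set of these. -/
theorem eventually_lt_ncard_of_arrows (hq : 1 ≤ q) {s : Fin (q + p) → ℕ} (hs : ∀ i, 1 ≤ s i)
    {t : Fin q → ℝ} (ht : ∀ i, 0 < t i)
    {tfix : Fin p → ℕ} (htfix : ∀ j, s (Fin.natAdd q j) ≤ tfix j) {tn : Fin q → ℕ → ℕ}
    (htn : ∀ i, (fun n : ℕ => (tn i n : ℝ) - t i * n) =o[atTop] (fun n : ℕ => (n : ℝ)))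
    {a x : ℝ} (ha : 0 < a) (hxa : x < a) (hA : ∀ k, Feasible s t k a) :
    ∀ᶠ n : ℕ in atTop, ∀ (m : ℕ) (G : SimpleGraph (Fin m)),
      Arrows G (forbidden s tn tfix n) → x * n < G.edgeSet.ncard := by
  classical
  have : NeZero q := ⟨by omega⟩
  obtain ⟨i₀, hi₀⟩ := Finite.exists_min t
  -- Half the least slope, so that vertices outside `L` have degree below every `tn i n`.
  set τ := t i₀ / 2 with hτ
  have hτ0 : 0 < τ := half_pos (ht i₀)
  set D := ⌊2 * x / τ⌋₊
  set C : ℝ := a * (2 ^ D * (q + p) ^ D + D)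
  have hlarge : ∀ᶠ n : ℕ in atTop, ∀ i, t i * x * n + C < a * tn i n :=
    eventually_all.2 fun i => eventually_add_lt_mul (ht i) (htn i) ha hxa C
  have hdeg : ∀ᶠ n : ℕ in atTop, ∀ i, τ * n < tn i n := by
    refine eventually_all.2 fun i => ?_
    filter_upwards [eventually_add_lt_mul (ht i) (htn i) one_pos (x := 1 / 2) (by norm_num) 0]
      with n hn
    have : τ * n ≤ t i / 2 * n := by gcongr; linarith [hi₀ i]
    linarith
  filter_upwards [hlarge, hdeg, eventually_gt_atTop 0] with n h1 h2 hn m G hG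
  by_contra! hle
  have hn' : (0 : ℝ) < n := by exact_mod_cast hn
  let L : Finset (Fin m) := {v | τ * n < G.degree v}
  have hL : #L ≤ D := by
    refine Nat.le_floor ((le_div_iff₀ hτ0).2 (le_of_mul_le_mul_right ?_ hn'))
    calc (#L : ℝ) * τ * n = ∑ v ∈ L, τ * n := by rw [sum_const, nsmul_eq_mul, mul_assoc]
      _ ≤ ∑ v ∈ L, (G.degree v : ℝ) := sum_le_sum fun v hv => (mem_filter.1 hv).2.le
      _ ≤ ∑ v, (G.degree v : ℝ) := sum_le_sum_of_subset_of_nonneg (subset_univ _)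
          (fun _ _ _ => Nat.cast_nonneg _)
      _ = 2 * G.edgeSet.ncard := by
          rw [← SimpleGraph.coe_edgeFinset, Set.ncard_coe_finset]
          exact_mod_cast G.sum_degrees_eq_twice_card_edges
      _ ≤ 2 * x * n := by linarith
  obtain ⟨i, hi⟩ := exists_mul_le_of_arrows hq hs (fun i => (ht i).le) htfix ha.le hA G
    (fun j => tn j n) L hL (fun v i hv => by
      simp only [L, mem_filter_univ]
      exact (h2 i).trans_le (by exact_mod_cast hv)) hG
  have h3 := mul_le_mul_of_nonneg_left hle (ht i).le
  linarith [h1 i]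

section BipartiteGraphs

variable {s : Fin (q + p) → ℕ} {t : Fin q → ℝ} {tfix : Fin p → ℕ} {a : ℝ} {k : ℕ}

theorem exists_arrows_of_not_feasible (ht : ∀ i, 0 < t i) (ha : 0 ≤ a) (hk0 : 0 < k)
    (hk : ¬ Feasible s t k a) (T : Fin q → ℕ) :
    ∃ N, Arrows (K k N) (fun i => K (s i) (Fin.append T tfix i)) := by
  set C := 2 ^ k * ∑ j, tfix j
  have h : ∀ᶠ N : ℕ in atTop, ∀ i, a * T i + k * t i * C < k * t i * N :=
    eventually_all.2 fun i => eventually_lt_mul_natCast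
      (mul_pos (by exact_mod_cast hk0) (ht i)) _
  obtain ⟨N, hN, hN'⟩ := (h.and (eventually_gt_atTop C)).exists
  refine ⟨N, arrows_of_not_feasible ha hk (by exact_mod_cast hN') (fun i => ?_)
    fun i => (ht i).le⟩
  linarith [hN i]

theorem eventually_arrows_of_not_feasible (ht : ∀ i, 0 < t i) {tn : Fin q → ℕ → ℕ}
    (htn : ∀ i, (fun n : ℕ => (tn i n : ℝ) - t i * n) =o[atTop] (fun n : ℕ => (n : ℝ)))
    (ha : 0 < a) (hk0 : 0 < k) (hk : ¬ Feasible s t k a) {y : ℝ} (hay : a < y) :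
    ∀ᶠ n : ℕ in atTop, Arrows (K k ⌈y * n / k⌉₊) (forbidden s tn tfix n) := by
  set C := 2 ^ k * ∑ j, tfix j
  have hk' : (0 : ℝ) < k := by exact_mod_cast hk0
  have h : ∀ᶠ n : ℕ in atTop, ∀ i, a * tn i n + k * t i * C < t i * y * n :=
    eventually_all.2 fun i => eventually_mul_add_lt (ht i) (htn i) ha hay _
  filter_upwards [h, eventually_lt_mul_natCast (ha.trans hay) (k * C)] with n h1 h2
  have hN := Nat.le_ceil (y * n / k)
  refine arrows_of_not_feasible ha.le hk ?_ (fun i => ?_) (fun i => (ht i).le)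
  · refine lt_of_lt_of_le ?_ hN
    rwa [lt_div_iff₀ hk', mul_comm]
  · rw [div_le_iff₀ hk'] at hN
    have := mul_le_mul_of_nonneg_left hN (ht i).le
    linarith [h1 i]

end BipartiteGraphs

end SizeRamsey

open SizeRamsey in
theorem mainTheorem3 (q p : ℕ) (hq : 1 ≤ q)
    (s : Fin (q + p) → ℕ) (hs : ∀ i, 1 ≤ s i)
    (t : Fin q → ℝ) (ht : ∀ i, 0 < t i)
    (tfix : Fin p → ℕ) (htfix : ∀ j, s (Fin.natAdd q j) ≤ tfix j)
    (tn : Fin q → ℕ → ℕ)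
    (htn : ∀ i, (fun n : ℕ => (tn i n : ℝ) - t i * n) =o[atTop] (fun n : ℕ => (n : ℝ))) :
    (∀ n, (SizeRamsey.arrowingSizes (SizeRamsey.forbidden s tn tfix n)).Nonempty) ∧
    ∃ Λ : ℝ,
      Tendsto (fun n : ℕ =>
        (SizeRamsey.sizeRamsey (SizeRamsey.forbidden s tn tfix n) : ℝ) / n) atTop (𝓝 Λ) ∧
      ∀ l : ℕ, Λ / (∑ i, t i) < l →
        (∀ n, (SizeRamsey.bipartiteArrowingSizes l
          (SizeRamsey.forbidden s tn tfix n)).Nonempty) ∧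
        Tendsto (fun n : ℕ =>
          (SizeRamsey.bipartiteSizeRamsey l (SizeRamsey.forbidden s tn tfix n) : ℝ) / n)
          atTop (𝓝 Λ) := by
  have ht0 : ∀ i, 0 ≤ t i := fun i => (ht i).le
  have htsum : 0 < ∑ i, t i :=
    Finset.sum_pos (fun i _ => ht i) ⟨⟨0, by omega⟩, Finset.mem_univ _⟩
  let B : Set ℝ := {a | 0 ≤ a ∧ ∀ k, Feasible s t k a}
  have hB0 : (0 : ℝ) ∈ B :=
    ⟨le_rfl, fun k => feasible_of_le hs ht0 htsum (Or.inr (by positivity))⟩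
  have hBdd : BddAbove B := ⟨_, fun a ha => le_of_feasible hq ht0 ha.1 (ha.2 _)⟩
  set Λ := sSup B
  have hΛ : 0 ≤ Λ := le_csSup hBdd hB0
  -- Above `Λ` some `k` is infeasible; below `l * ∑ i, t i` such a `k` is smaller than `l`.
  have hupper : ∀ l : ℕ, Λ / (∑ i, t i) < l → ∀ z, Λ < z →
      ∃ k a, 0 < k ∧ k ≤ l ∧ 0 < a ∧ a < z ∧ ¬ Feasible s t k a := by
    intro l hl z hz
    rw [div_lt_iff₀ htsum] at hl
    obtain ⟨a, hΛa, ha⟩ := exists_between (lt_min hl hz)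
    have ha0 : 0 < a := hΛ.trans_lt hΛa
    have haB : a ∉ B := fun h => (le_csSup hBdd h).not_gt hΛa
    obtain ⟨k, hk⟩ : ∃ k, ¬ Feasible s t k a := by
      by_contra! h; exact haB ⟨ha0.le, h⟩
    have hk' : ¬ (k = 0 ∨ a ≤ k * ∑ i, t i) := fun h => hk (feasible_of_le hs ht0 htsum h)
    push Not at hk'
    refine ⟨k, a, Nat.pos_of_ne_zero hk'.1, ?_, ha0, (lt_min_iff.1 ha).2, hk⟩
    have h1 : (k : ℝ) * ∑ i, t i < l * ∑ i, t i := hk'.2.trans (lt_min_iff.1 ha).1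
    exact_mod_cast (lt_of_mul_lt_mul_right h1 htsum.le).le
  have hne : ∀ l : ℕ, Λ / (∑ i, t i) < l →
      ∀ n, (bipartiteArrowingSizes l (forbidden s tn tfix n)).Nonempty := by
    intro l hl n
    obtain ⟨k, a, hk0, hkl, ha, -, hk⟩ := hupper l hl (Λ + 1) (by linarith)
    obtain ⟨N, hN⟩ := exists_arrows_of_not_feasible (tfix := tfix) ht ha.le hk0 hk
      (fun j => tn j n)
    exact ⟨_, k, N, hkl, hN, rfl⟩
  obtain ⟨l₀, hl₀⟩ := exists_nat_gt (Λ / ∑ i, t i)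
  have hne' : ∀ n, (arrowingSizes (forbidden s tn tfix n)).Nonempty :=
    fun n => (hne l₀ hl₀ n).mono (bipartiteArrowingSizes_subset _ _)
  have hlow : ∀ z < Λ, ∀ᶠ n : ℕ in atTop,
      z < (sizeRamsey (forbidden s tn tfix n) : ℝ) / n := by
    intro z hz
    rcases lt_or_ge z 0 with hz0 | hz0
    · exact Eventually.of_forall fun n => hz0.trans_le (by positivity)
    obtain ⟨a, ha, hza⟩ := exists_lt_of_lt_csSup ⟨0, hB0⟩ hz
    filter_upwards [eventually_lt_ncard_of_arrows hq hs ht htfix htn (hz0.trans_lt hza) hza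
      ha.2, eventually_gt_atTop 0] with n hn hn0
    obtain ⟨m, G, hG, hGe⟩ := Nat.sInf_mem (hne' n)
    rw [lt_div_iff₀ (by exact_mod_cast hn0), sizeRamsey, ← hGe]
    exact hn m G hG
  have hle : ∀ l : ℕ, Λ / (∑ i, t i) < l → ∀ n,
      sizeRamsey (forbidden s tn tfix n) ≤ bipartiteSizeRamsey l (forbidden s tn tfix n) :=
    fun l hl n => Nat.sInf_le (bipartiteArrowingSizes_subset _ _ (Nat.sInf_mem (hne l hl n)))
  have hup : ∀ l : ℕ, Λ / (∑ i, t i) < l → ∀ z, Λ < z → ∀ᶠ n : ℕ in atTop,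
      (bipartiteSizeRamsey l (forbidden s tn tfix n) : ℝ) / n < z := by
    intro l hl z hz
    obtain ⟨k, a, hk0, hkl, ha, haz, hk⟩ := hupper l hl z hz
    obtain ⟨y, hay, hyz⟩ := exists_between haz
    have hk' : (0 : ℝ) < k := by exact_mod_cast hk0
    filter_upwards [eventually_arrows_of_not_feasible (tfix := tfix) ht htn ha hk0 hk hay,
      eventually_lt_mul_natCast (sub_pos.2 hyz) k, eventually_gt_atTop 0] with n h1 h2 hn0
    rw [div_lt_iff₀ (by exact_mod_cast hn0)]
    have h3 : bipartiteSizeRamsey l (forbidden s tn tfix n) ≤ k * ⌈y * n / k⌉₊ :=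
      Nat.sInf_le ⟨k, _, hkl, h1, ncard_edgeSet_K _ _⟩
    have h4 : (⌈y * n / k⌉₊ : ℝ) < y * n / k + 1 :=
      Nat.ceil_lt_add_one (by have := ha.trans hay; positivity)
    calc (bipartiteSizeRamsey l (forbidden s tn tfix n) : ℝ) ≤ k * ⌈y * n / k⌉₊ := by
          exact_mod_cast h3
      _ ≤ k * (y * n / k + 1) := by gcongr
      _ = y * n + k := by field_simp
      _ < z * n := by linarith
  refine ⟨hne', Λ, tendsto_order.2 ⟨hlow, fun z hz => ?_⟩, fun l hl => ⟨hne l hl,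
    tendsto_order.2 ⟨fun z hz => ?_, hup l hl⟩⟩⟩
  · filter_upwards [hup l₀ hl₀ z hz] with n hn
    refine lt_of_le_of_lt ?_ hn
    gcongr
    exact hle l₀ hl₀ n
  · filter_upwards [hlow z hz] with n hn
    refine hn.trans_le ?_
    gcongr
    exact hle l hl n
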